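/- Notation. For $\pi\in S_m$, $\sigma\in S_n$ the concatenation $\pi+\sigma\in S_{m+n}$ acts as $\pi$ on the first $m$ positions and as $\sigma$ translated by $m$ on the last $n$ positions. A permutation (of positive order) is connected if it is not a concatenation of permutations of lower order; every permutation is uniquely a concatenation of connected permutations (its split decomposition). The split type of a permutation is the concatenation of the nontrivial parts of its split decomposition, and a permutation is called a split type if it is the split type of some permutation. For a split type $\sigma$, $q(\sigma)$ is the number of connected parts of $\sigma$. Put $\ell_1(\sigma)=\sum_i|\sigma(i)-i|$, and let $\beta(R,m,q)$ be the number of split types $\sigma\in S_m$ with $\ell_1(\sigma)=R$ and $q(\sigma)=q$ (zero if $m<0$). Lemma. Let $k\ge 1$ be an integer. The coefficients $\beta(2k,m,q)$ for $m=k+q,\ldots,k+q-3$ are $$\beta(2k,k+q,q)=\binom{k-1}{q-1}3^{k-q}$$ for all $1\le q\le k$; $$\beta(2k,k+q-1,q)=4(k-3)\binom{k-4}{q-1}3^{k-q-3}$$ if $1\le q\le k-3$, and $0$ otherwise; $$\beta(2k,k+q-2,q)=4(k-5)\Bigl(2(k-6)\binom{k-7}{q-1}+15\binom{k-6}{q-1}\Bigr)3^{k-q-6}$$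 if $1\le q\le k-5$, and $0$ otherwise (for $k=6$ the first summand in the bracket is $0$); $$\beta(2k,k+q-3,q)=4(k-7)\binom{k-8}{q-1}\bigl(8(k-q)^2+60(k-q)-137\bigr)3^{k-q-10}$$ if $1\le q\le k-7$, and $0$ otherwise. -/

import Mathlib

namespace SplitTypes

/-- Permutations of arbitrary finite order: a pair `⟨m, π⟩` with `π ∈ S_m`, where the set
`{1, …, m}` is modelled by `Fin m = {0, …, m - 1}`. -/
abbrev FinPerm : Type := Σ m : ℕ, Equiv.Perm (Fin m)

/-- The concatenation `π + σ ∈ S_{m+n}` of `π ∈ S_m` and `σ ∈ S_n`: it acts as `π` on the first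
`m` positions, and as the translate of `σ` by `m` on the last `n` positions. -/
def concat (π σ : FinPerm) : FinPerm :=
  ⟨π.1 + σ.1, finSumFinEquiv.permCongr (Equiv.sumCongr π.2 σ.2)⟩

/-- The concatenation of a finite list of permutations; the empty list gives the element
of `S_0`. -/
def concatList (l : List FinPerm) : FinPerm :=
  l.foldr concat ⟨0, 1⟩

/-- A permutation (of positive order) is connected if it is not a concatenation of
permutations of lower order. -/
def IsConnected (σ : FinPerm) : Prop :=
  0 < σ.1 ∧ ¬ ∃ τ υ : FinPerm, τ.1 < σ.1 ∧ υ.1 < σ.1 ∧ concat τ υ = σ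

/-- `l` is the (unique) decomposition of `σ` as a concatenation of connected permutations. -/
def IsSplitDecomposition (l : List FinPerm) (σ : FinPerm) : Prop :=
  (∀ τ ∈ l, IsConnected τ) ∧ concatList l = σ

/-- `σ` is the split type of `π`: the concatenation of the nontrivial (that is, non-identity)
permutations in the split decomposition of `π`. -/
def IsSplitTypeOf (σ π : FinPerm) : Prop :=
  ∃ l : List FinPerm, IsSplitDecomposition l π ∧
    σ = concatList (l.filter fun τ => decide (τ.2 ≠ 1))

/-- `σ` is a split type: it is the split type of some permutation. -/
def IsSplitType (σ : FinPerm) : Prop :=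
  ∃ π : FinPerm, IsSplitTypeOf σ π

/-- `q(σ) = q`: the split decomposition of `σ` has exactly `q` connected parts. -/
def HasNumParts (σ : FinPerm) (q : ℕ) : Prop :=
  ∃ l : List FinPerm, IsSplitDecomposition l σ ∧ l.length = q

/-- The distance `ℓ₁(u, v) = ∑ᵢ |u(i) - v(i)|` on `S_m`. -/
def l1Dist {m : ℕ} (u v : Equiv.Perm (Fin m)) : ℕ :=
  ∑ i : Fin m, (((u i : ℕ) : ℤ) - ((v i : ℕ) : ℤ)).natAbs

/-- The distance `ℓ₁(u)` from `u` to the identity. -/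
def l1 {m : ℕ} (u : Equiv.Perm (Fin m)) : ℕ :=
  l1Dist u 1

/-- `β(R, m, q)`: the number of split types `σ ∈ S_m` with `ℓ₁(σ) = R` and `q(σ) = q`. -/
noncomputable def beta (R m q : ℕ) : ℕ :=
  Nat.card {σ : Equiv.Perm (Fin m) //
    IsSplitType ⟨m, σ⟩ ∧ l1 σ = R ∧ HasNumParts ⟨m, σ⟩ q}

end SplitTypes

namespace SplitTypes

open Finset

/-! Record a permutation σ of order m by its heights h(n), the number of positions before n that σ
sends to n or beyond. Zeros of h cut σ into its connected parts. So q is the number of zeros among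
h(1), …, h(m), and σ is a split type exactly when no two consecutive heights vanish
(`isSplitType_iff`). Each level n is crossed upwards and downwards equally often, so ℓ₁(σ) is twice
the sum of the heights (`l1_eq`). If e is the total excess of the nonzero heights over 1, then ℓ₁(σ)
= 2k amounts to m = k + q - e. The four formulas are therefore the cases e = 0, 1, 2, 3
(`beta_eq_profileCount`).

To count permutations by height profile, build the graph of σ inside growing n × n boxes. The
unmatched elements form the height, and one step h → h + 1, h → h, h → h - 1 can be made in 1, 2h +
1, h² ways (`card_extensions_defect`). A return to 0 from height 3 costs excess at least 2 + 1 + 1 =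
4, so for e ≤ 3 only heights 0, 1, 2 matter.

With B = X²/(1 - 3X), the generating functions F and G of profiles ending at height 0 and 2 satisfy
F_e(q+1) = B(F_e(q) + 4G_e(q)) and, for e ≤ 2, G_{e+1}(q) = B(F_e(q) + 4G_e(q)) + 5X G_e(q). These
are solved in closed form for e ≤ 3, and the coefficients are read off from powers of 1/(1 - 3X). -/

/-- The height of `s` at `n`: the number of positions before `n` that are sent to `n` or beyond. -/
def height (s : FinPerm) (n : ℕ) : ℕ :=
  ∑ i : Fin s.1, if (i : ℕ) < n ∧ n ≤ (s.2 i : ℕ) then 1 else 0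

/-- The number of zeros among `h 1, …, h m`. -/
def numZeros (m : ℕ) (h : ℕ → ℕ) : ℕ := ∑ i ∈ range m, if h (i + 1) = 0 then 1 else 0

/-- The excess of the nonzero terms among `h 1, …, h m` over `1`. -/
def excess (m : ℕ) (h : ℕ → ℕ) : ℕ := ∑ i ∈ range m, (h (i + 1) - 1)

/-- No two consecutive terms of `h 0, …, h m` vanish. -/
def Sparse (m : ℕ) (h : ℕ → ℕ) : Prop := ∀ i < m, ¬ (h i = 0 ∧ h (i + 1) = 0)

/-! ### Heights and split decompositions -/

lemma height_eq_zero_iff (s : FinPerm) (n : ℕ) :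
    height s n = 0 ↔ ∀ i : Fin s.1, (i : ℕ) < n → (s.2 i : ℕ) < n := by
  simp [height]

lemma height_zero (s : FinPerm) : height s 0 = 0 := by
  simp [height]

lemma height_self (s : FinPerm) : height s s.1 = 0 := by
  rw [height_eq_zero_iff]
  intro i _
  exact (s.2 i).isLt

lemma concat_castAdd (a b : FinPerm) (i : Fin a.1) :
    (concat a b).2 (Fin.castAdd b.1 i) = Fin.castAdd b.1 (a.2 i) := by
  change finSumFinEquiv.permCongr (Equiv.sumCongr a.2 b.2) (Fin.castAdd b.1 i) = _
  rw [Equiv.permCongr_apply]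
  simp

lemma concat_natAdd (a b : FinPerm) (i : Fin b.1) :
    (concat a b).2 (Fin.natAdd a.1 i) = Fin.natAdd a.1 (b.2 i) := by
  change finSumFinEquiv.permCongr (Equiv.sumCongr a.2 b.2) (Fin.natAdd a.1 i) = _
  rw [Equiv.permCongr_apply]
  simp

lemma height_concat (a b : FinPerm) (n : ℕ) : height (concat a b) n =
    height a n + ∑ i : Fin b.1, if a.1 + (i : ℕ) < n ∧ n ≤ a.1 + (b.2 i : ℕ) then 1 else 0 := by
  have := Fin.sum_univ_add (fun i : Fin (a.1 + b.1) =>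
    if (i : ℕ) < n ∧ n ≤ ((concat a b).2 i : ℕ) then 1 else 0)
  refine this.trans ?_
  congr 1
  · refine Finset.sum_congr rfl fun i _ => ?_
    rw [concat_castAdd]; rfl
  · refine Finset.sum_congr rfl fun i _ => ?_
    rw [concat_natAdd]; rfl

lemma height_concat_left (a b : FinPerm) {n : ℕ} (hn : n ≤ a.1) :
    height (concat a b) n = height a n := by
  rw [height_concat, Finset.sum_eq_zero, add_zero]
  intro i _
  rw [if_neg]
  omega

lemma height_concat_right (a b : FinPerm) (n : ℕ) :
    height (concat a b) (a.1 + n) = height b n := by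
  rw [height_concat]
  have h : height a (a.1 + n) = 0 := by
    rw [height_eq_zero_iff]
    intro i _
    have := (a.2 i).isLt
    omega
  rw [h, zero_add]
  simp [height]

lemma numZeros_concat (a b : FinPerm) : numZeros (concat a b).1 (height (concat a b)) =
    numZeros a.1 (height a) + numZeros b.1 (height b) := by
  have h : (concat a b).1 = a.1 + b.1 := rfl
  unfold numZeros
  rw [h, Finset.sum_range_add]
  congr 1
  · refine Finset.sum_congr rfl fun i hi => ?_
    rw [height_concat_left _ _ (by simpa using hi)]
  · refine Finset.sum_congr rfl fun i _ => ?_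
    rw [add_assoc, height_concat_right]

lemma sparse_concat_iff (a b : FinPerm) : Sparse (concat a b).1 (height (concat a b)) ↔
    Sparse a.1 (height a) ∧ Sparse b.1 (height b) := by
  have h : (concat a b).1 = a.1 + b.1 := rfl
  constructor
  · intro H
    refine ⟨fun i hi => ?_, fun i hi => ?_⟩
    · have := H i (by omega)
      rwa [height_concat_left _ _ hi.le, height_concat_left _ _ hi] at this
    · have := H (a.1 + i) (by omega)
      rwa [add_assoc, height_concat_right, height_concat_right] at this
  · rintro ⟨ha, hb⟩ i hi
    rcases lt_or_ge i a.1 with h1 | h1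
    · rw [height_concat_left _ _ h1.le, height_concat_left _ _ h1]
      exact ha i h1
    · obtain ⟨j, rfl⟩ := Nat.exists_eq_add_of_le h1
      rw [add_assoc, height_concat_right, height_concat_right]
      exact hb j (by omega)

/-- At height zero the permutation maps the first n positions into themselves, hence, by finiteness,
it also preserves the remaining ones. -/
lemma exists_concat_of_height_eq_zero (s : FinPerm) {n : ℕ} (hn : n ≤ s.1)
    (h : height s n = 0) : ∃ a b : FinPerm, a.1 = n ∧ concat a b = s := by
  obtain ⟨m, σ⟩ := s
  obtain ⟨p, rfl⟩ := Nat.exists_eq_add_of_le hn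
  rw [height_eq_zero_iff] at h
  have hm : Set.MapsTo (finSumFinEquiv.symm.permCongr σ)
      (Set.range (Sum.inl : Fin n → Fin n ⊕ Fin p)) (Set.range Sum.inl) := by
    rintro _ ⟨i, rfl⟩
    have hi := h (Fin.castAdd p i) (by simp)
    refine ⟨⟨_, hi⟩, ?_⟩
    rw [Equiv.permCongr_apply, Equiv.eq_symm_apply]
    ext
    simp
  obtain ⟨⟨α, β⟩, hab⟩ := Equiv.Perm.mem_sumCongrHom_range_of_perm_mapsTo_inl hm
  refine ⟨⟨n, α⟩, ⟨p, β⟩, rfl, ?_⟩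
  have hab' : Equiv.sumCongr α β = finSumFinEquiv.symm.permCongr σ := hab
  simp only [concat, hab']
  congr 1
  ext i
  simp

lemma isConnected_iff (s : FinPerm) :
    IsConnected s ↔ 0 < s.1 ∧ ∀ n, 0 < n → n < s.1 → height s n ≠ 0 := by
  refine and_congr_right fun _ => ⟨fun H n h0 hn hz => ?_, ?_⟩
  · obtain ⟨a, b, rfl, rfl⟩ := exists_concat_of_height_eq_zero s hn.le hz
    exact H ⟨a, b, hn, Nat.lt_add_of_pos_left h0, rfl⟩
  · rintro H ⟨a, b, ha, hb, rfl⟩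
    have h : (concat a b).1 = a.1 + b.1 := rfl
    refine H a.1 (by omega) ha ?_
    rw [height_concat_left _ _ le_rfl, height_self]

lemma IsConnected.numZeros {s : FinPerm} (hs : IsConnected s) :
    numZeros s.1 (height s) = 1 := by
  rw [isConnected_iff] at hs
  obtain ⟨h0, hs⟩ := hs
  obtain ⟨m, hm⟩ := Nat.exists_eq_succ_of_ne_zero h0.ne'
  have hself := height_self s
  rw [hm] at hs hself
  rw [SplitTypes.numZeros, hm, Finset.sum_range_succ, if_pos hself, Finset.sum_eq_zero, zero_add]
  intro i hi
  rw [if_neg]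
  exact hs _ (by omega) (by simpa using hi)

/-- Cutting at the first positive zero of the height splits off a connected part; the rest has
smaller order. -/
lemma exists_isSplitDecomposition (s : FinPerm) : ∃ l, IsSplitDecomposition l s := by
  induction hm : s.1 using Nat.strong_induction_on generalizing s with
  | _ m ih =>
    rcases Nat.eq_zero_or_pos m with rfl | h0
    · obtain ⟨m, σ⟩ := s
      obtain rfl : m = 0 := hm
      refine ⟨[], by simp, ?_⟩
      simp only [concatList, List.foldr_nil]
      congr 1
      exact Subsingleton.elim _ _
    · have hex : ∃ n, 0 < n ∧ height s n = 0 := ⟨m, h0, by rw [← hm]; exact height_self s⟩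
      classical
      have hle : Nat.find hex ≤ s.1 := Nat.find_le ⟨by omega, height_self s⟩
      obtain ⟨a, b, han, rfl⟩ :=
        exists_concat_of_height_eq_zero s hle (Nat.find_spec hex).2
      have hpos := (Nat.find_spec hex).1
      have hab : (concat a b).1 = a.1 + b.1 := rfl
      obtain ⟨l, hl, hlb⟩ := ih b.1 (by omega) b rfl
      refine ⟨a :: l, ?_, ?_⟩
      · simp only [List.mem_cons, forall_eq_or_imp]
        refine ⟨(isConnected_iff a).2 ⟨by omega, fun n hn hna => ?_⟩, hl⟩
        rw [← height_concat_left a b hna.le]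
        have := Nat.find_min hex (m := n) (by omega)
        tauto
      · rw [← hlb]; rfl

lemma numZeros_concatList {l : List FinPerm} (hl : ∀ τ ∈ l, IsConnected τ) :
    numZeros (concatList l).1 (height (concatList l)) = l.length := by
  induction l with
  | nil => rfl
  | cons a l ih =>
    simp only [List.mem_cons, forall_eq_or_imp] at hl
    have : concatList (a :: l) = concat a (concatList l) := rfl
    rw [this, numZeros_concat, ih hl.2, hl.1.numZeros, List.length_cons, add_comm]

lemma sparse_concatList_iff (l : List FinPerm) :
    Sparse (concatList l).1 (height (concatList l)) ↔ ∀ τ ∈ l, Sparse τ.1 (height τ) := by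
  induction l with
  | nil => simp [Sparse, concatList]
  | cons a l ih =>
    have : concatList (a :: l) = concat a (concatList l) := rfl
    rw [this, sparse_concat_iff, ih]
    simp

lemma hasNumParts_iff (s : FinPerm) (q : ℕ) :
    HasNumParts s q ↔ numZeros s.1 (height s) = q := by
  constructor
  · rintro ⟨l, ⟨hl, rfl⟩, rfl⟩
    exact numZeros_concatList hl
  · rintro rfl
    obtain ⟨l, hl, rfl⟩ := exists_isSplitDecomposition s
    exact ⟨l, ⟨hl, rfl⟩, (numZeros_concatList hl).symm⟩

/-- The heights of a connected permutation vanish only at its two ends, which are adjacent only in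
order 1, where the permutation is the identity. Conversely, an identity has all heights zero. -/
lemma IsConnected.sparse_iff {s : FinPerm} (hs : IsConnected s) :
    Sparse s.1 (height s) ↔ s.2 ≠ 1 := by
  constructor
  · intro h h1
    refine h 0 hs.1 ⟨height_zero s, ?_⟩
    rw [height_eq_zero_iff]
    simp [h1]
  · rintro h i hi ⟨h1, h2⟩
    rw [isConnected_iff] at hs
    have hi0 : i = 0 := by
      by_contra h0
      exact hs.2 i (Nat.pos_of_ne_zero h0) hi h1
    subst hi0
    have hs1 : s.1 = 1 := by
      by_contra hne
      exact hs.2 1 one_pos (by omega) h2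
    obtain ⟨m, σ⟩ := s
    obtain rfl : m = 1 := hs1
    exact h (Subsingleton.elim _ _)

/-- Sparsity can be tested part by part, and on a part it means nontriviality. A sparse permutation
loses nothing under the filter, so it is its own split type. -/
lemma isSplitType_iff (s : FinPerm) : IsSplitType s ↔ Sparse s.1 (height s) := by
  constructor
  · rintro ⟨π, l, ⟨hl, -⟩, rfl⟩
    rw [sparse_concatList_iff]
    intro τ hτ
    rw [List.mem_filter, decide_eq_true_iff] at hτ
    exact (hl τ hτ.1).sparse_iff.2 hτ.2
  · intro h
    obtain ⟨l, hl, rfl⟩ := exists_isSplitDecomposition s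
    refine ⟨concatList l, l, ⟨hl, rfl⟩, ?_⟩
    rw [sparse_concatList_iff] at h
    rw [List.filter_eq_self.2]
    intro τ hτ
    rw [decide_eq_true_iff]
    exact (hl τ hτ).sparse_iff.1 (h τ hτ)

/-! ### The ℓ₁ distance as a sum of heights -/

lemma height_eq_sum_symm {m : ℕ} (σ : Equiv.Perm (Fin m)) (n : ℕ) :
    height ⟨m, σ⟩ n = ∑ i : Fin m, if (σ i : ℕ) < n ∧ n ≤ (i : ℕ) then 1 else 0 := by
  have h := Equiv.sum_comp σ (fun i : Fin m => if (i : ℕ) < n then 1 else 0)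
  have h1 : ∑ i : Fin m, (if (i : ℕ) < n then 1 else 0) = height ⟨m, σ⟩ n +
      ∑ i : Fin m, if (i : ℕ) < n ∧ (σ i : ℕ) < n then 1 else 0 := by
    rw [height, ← Finset.sum_add_distrib]
    refine Finset.sum_congr rfl fun i _ => ?_
    dsimp only
    split_ifs <;> omega
  have h2 : ∑ i : Fin m, (if (σ i : ℕ) < n then 1 else 0) =
      (∑ i : Fin m, if (σ i : ℕ) < n ∧ n ≤ (i : ℕ) then 1 else 0) +
      ∑ i : Fin m, if (i : ℕ) < n ∧ (σ i : ℕ) < n then 1 else 0 := by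
    rw [← Finset.sum_add_distrib]
    refine Finset.sum_congr rfl fun i _ => ?_
    split_ifs <;> omega
  omega

lemma sum_range_between (a b m : ℕ) (hb : b < m) :
    ∑ n ∈ range m, (if a < n + 1 ∧ n + 1 ≤ b then 1 else 0) = b - a := by
  rw [← Finset.card_filter]
  have : (range m).filter (fun n => a < n + 1 ∧ n + 1 ≤ b) = Finset.Ico a b := by
    ext n
    simp only [mem_filter, Finset.mem_range, Finset.mem_Ico]
    omega
  rw [this, Nat.card_Ico]

/-- The displacement |σ(i) - i| counts the levels crossed between i and σ(i). Summing by level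
instead, upward crossings give the height and downward crossings give it again by
`height_eq_sum_symm`. -/
lemma l1_eq {m : ℕ} (σ : Equiv.Perm (Fin m)) :
    l1 σ = 2 * ∑ n ∈ range m, height ⟨m, σ⟩ (n + 1) := by
  rw [two_mul]
  nth_rw 2 [Finset.sum_congr rfl fun n _ => height_eq_sum_symm σ (n + 1)]
  simp only [height]
  rw [Finset.sum_comm, Finset.sum_comm (s := range m), ← Finset.sum_add_distrib, l1, l1Dist]
  refine Finset.sum_congr rfl fun i _ => ?_
  rw [sum_range_between _ _ _ i.isLt, sum_range_between _ _ _ (σ i).isLt, Equiv.Perm.one_apply]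
  omega

/-- Termwise, h + [h = 0] = (h - 1) + 1 with truncated subtraction. -/
lemma sum_add_numZeros (m : ℕ) (h : ℕ → ℕ) :
    (∑ n ∈ range m, h (n + 1)) + numZeros m h = excess m h + m := by
  induction m with
  | zero => simp [numZeros, excess]
  | succ m ih =>
    simp only [numZeros, excess, Finset.sum_range_succ] at ih ⊢
    split_ifs <;> omega

/-! ### Partial permutations and their one-step extensions -/

/-- `S` is the graph of a partial permutation of `{0, …, n - 1}`. -/
def IsPartialPerm (n : ℕ) (S : Finset (ℕ × ℕ)) : Prop :=
  (∀ p ∈ S, p.1 < n ∧ p.2 < n) ∧ ∀ p ∈ S, ∀ p' ∈ S, p.1 = p'.1 ↔ p.2 = p'.2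

open Classical in
/-- The graphs of the partial permutations of `{0, …, n - 1}`. -/
noncomputable def partialPerms (n : ℕ) : Finset (Finset (ℕ × ℕ)) :=
  {S ∈ (range n ×ˢ range n).powerset | IsPartialPerm n S}

/-- The restriction of a relation to `{0, …, n - 1}`. -/
def restrict (n : ℕ) (S : Finset (ℕ × ℕ)) : Finset (ℕ × ℕ) := {p ∈ S | p.1 < n ∧ p.2 < n}

/-- The number of elements of `{0, …, n - 1}` left unmatched by the restriction of `S`. -/
def defect (S : Finset (ℕ × ℕ)) (n : ℕ) : ℕ := n - #(restrict n S)

lemma mem_partialPerms {n : ℕ} {S : Finset (ℕ × ℕ)} :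
    S ∈ partialPerms n ↔ IsPartialPerm n S := by
  simp only [partialPerms, mem_filter, mem_powerset, and_iff_right_iff_imp]
  intro h p hp
  simpa using h.1 p hp

lemma restrict_restrict {i n : ℕ} (h : i ≤ n) (S : Finset (ℕ × ℕ)) :
    restrict i (restrict n S) = restrict i S := by
  ext p
  simp only [restrict, mem_filter]
  constructor
  · tauto
  · rintro ⟨h1, h2, h3⟩
    exact ⟨⟨h1, by omega, by omega⟩, h2, h3⟩

lemma defect_restrict {i n : ℕ} (h : i ≤ n) (S : Finset (ℕ × ℕ)) :
    defect (restrict n S) i = defect S i := by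
  rw [defect, restrict_restrict h, defect]

lemma restrict_subset (n : ℕ) (S : Finset (ℕ × ℕ)) : restrict n S ⊆ S :=
  filter_subset _ _

lemma restrict_insert {n : ℕ} {p : ℕ × ℕ} (hp : p.1 = n ∨ p.2 = n) (S : Finset (ℕ × ℕ)) :
    restrict n (insert p S) = restrict n S := by
  rw [restrict, filter_insert, if_neg (by omega), restrict]

namespace IsPartialPerm

variable {n : ℕ} {S T : Finset (ℕ × ℕ)}

lemma restrict_eq (h : IsPartialPerm n S) : restrict n S = S :=
  Finset.filter_true_of_mem h.1

lemma defect_self (h : IsPartialPerm n S) : defect S n = n - #S := by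
  rw [defect, h.restrict_eq]

lemma mono {m : ℕ} (h : IsPartialPerm n S) (hm : n ≤ m) : IsPartialPerm m S :=
  ⟨fun p hp => ⟨(h.1 p hp).1.trans_le hm, (h.1 p hp).2.trans_le hm⟩, h.2⟩

lemma restrict (h : IsPartialPerm n S) (m : ℕ) : IsPartialPerm m (restrict m S) :=
  ⟨fun _ hp => (mem_filter.1 hp).2, fun p hp p' hp' =>
    h.2 p (mem_filter.1 hp).1 p' (mem_filter.1 hp').1⟩

lemma insert (h : IsPartialPerm n S) {a b : ℕ} (ha : a < n) (hb : b < n)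
    (ha' : a ∉ S.image Prod.fst) (hb' : b ∉ S.image Prod.snd) :
    IsPartialPerm n (insert (a, b) S) := by
  rw [mem_image] at ha' hb'
  push Not at ha' hb'
  refine ⟨?_, ?_⟩
  · simp only [mem_insert, forall_eq_or_imp]
    exact ⟨⟨ha, hb⟩, h.1⟩
  · intro p hp p' hp'
    rw [mem_insert] at hp hp'
    rcases hp with rfl | hp <;> rcases hp' with rfl | hp'
    · simp
    · simp [(ha' _ hp').symm, (hb' _ hp').symm]
    · simp [ha' _ hp, hb' _ hp]
    · exact h.2 p hp p' hp'

lemma card_image_fst (h : IsPartialPerm n S) : #(S.image Prod.fst) = #S :=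
  card_image_of_injOn fun p hp p' hp' hpp => Prod.ext hpp ((h.2 p hp p' hp').1 hpp)

lemma card_image_snd (h : IsPartialPerm n S) : #(S.image Prod.snd) = #S :=
  card_image_of_injOn fun p hp p' hp' hpp => Prod.ext ((h.2 p hp p' hp').2 hpp) hpp

lemma image_fst_subset (h : IsPartialPerm n S) : S.image Prod.fst ⊆ range n := by
  intro x hx
  obtain ⟨p, hp, rfl⟩ := mem_image.1 hx
  exact Finset.mem_range.2 (h.1 p hp).1

lemma image_snd_subset (h : IsPartialPerm n S) : S.image Prod.snd ⊆ range n := by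
  intro x hx
  obtain ⟨p, hp, rfl⟩ := mem_image.1 hx
  exact Finset.mem_range.2 (h.1 p hp).2

lemma card_le (h : IsPartialPerm n S) : #S ≤ n := by
  have := card_le_card h.image_fst_subset
  rwa [h.card_image_fst, card_range] at this

lemma card_free_fst (h : IsPartialPerm n S) : #(range n \ S.image Prod.fst) = n - #S := by
  rw [card_sdiff_of_subset h.image_fst_subset, card_range, h.card_image_fst]

lemma card_free_snd (h : IsPartialPerm n S) : #(range n \ S.image Prod.snd) = n - #S := by
  rw [card_sdiff_of_subset h.image_snd_subset, card_range, h.card_image_snd]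

lemma fst_notMem_image (h : IsPartialPerm n S) : n ∉ S.image Prod.fst := fun hn => by
  simpa using h.image_fst_subset hn

lemma snd_notMem_image (h : IsPartialPerm n S) : n ∉ S.image Prod.snd := fun hn => by
  simpa using h.image_snd_subset hn

/-- The possible positions of an element added to `S` when the order increases by one. -/
lemma of_mem_sdiff (hT : IsPartialPerm (n + 1) T) {p : ℕ × ℕ}
    (hp : p ∈ T \ SplitTypes.restrict n T) : p.1 ≤ n ∧ p.2 ≤ n ∧ (p.1 = n ∨ p.2 = n) ∧
      p.1 ∉ (SplitTypes.restrict n T).image Prod.fst ∧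
      p.2 ∉ (SplitTypes.restrict n T).image Prod.snd := by
  rw [mem_sdiff] at hp
  obtain ⟨hpT, hpn⟩ := hp
  have hlt := hT.1 p hpT
  have hbox : ¬ (p.1 < n ∧ p.2 < n) := fun h => hpn (mem_filter.2 ⟨hpT, h⟩)
  refine ⟨by omega, by omega, by omega, fun h => ?_, fun h => ?_⟩
  · obtain ⟨p', hp', hpp⟩ := mem_image.1 h
    have := (hT.2 p' (mem_filter.1 hp').1 p hpT).1 hpp
    exact hpn ((Prod.ext hpp this : p' = p) ▸ hp')
  · obtain ⟨p', hp', hpp⟩ := mem_image.1 h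
    have := (hT.2 p' (mem_filter.1 hp').1 p hpT).2 hpp
    exact hpn ((Prod.ext this hpp : p' = p) ▸ hp')

end IsPartialPerm

/-- The extensions of `S` to order `n + 1` by `k` pairs. -/
noncomputable def extensions (n : ℕ) (S : Finset (ℕ × ℕ)) (k : ℕ) : Finset (Finset (ℕ × ℕ)) :=
  {T ∈ partialPerms (n + 1) | restrict n T = S ∧ #T = #S + k}

lemma mem_extensions {n k : ℕ} {S T : Finset (ℕ × ℕ)} : T ∈ extensions n S k ↔
    IsPartialPerm (n + 1) T ∧ restrict n T = S ∧ #T = #S + k := by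
  rw [extensions, mem_filter, mem_partialPerms]

lemma card_sdiff_of_mem_extensions {n k : ℕ} {S T : Finset (ℕ × ℕ)} (h : T ∈ extensions n S k) :
    #(T \ S) = k := by
  obtain ⟨-, rfl, h⟩ := mem_extensions.1 h
  rw [card_sdiff_of_subset (restrict_subset n T), h]
  omega

lemma subset_of_mem_extensions {n k : ℕ} {S T : Finset (ℕ × ℕ)} (h : T ∈ extensions n S k) :
    S ⊆ T := by
  obtain ⟨-, rfl, -⟩ := mem_extensions.1 h
  exact filter_subset _ _

lemma card_extensions_zero {n : ℕ} {S : Finset (ℕ × ℕ)} (hS : IsPartialPerm n S) :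
    #(extensions n S 0) = 1 := by
  rw [card_eq_one]
  refine ⟨S, eq_singleton_iff_unique_mem.2
    ⟨mem_extensions.2 ⟨hS.mono (Nat.le_succ n), hS.restrict_eq, rfl⟩, fun T hT => ?_⟩⟩
  refine (eq_of_subset_of_card_le (subset_of_mem_extensions hT) ?_).symm
  exact (mem_extensions.1 hT).2.2.le

/-- The new pair is (n, n), or it joins n to one of the n - #S free elements on either side. -/
lemma card_extensions_one {n : ℕ} {S : Finset (ℕ × ℕ)} (hS : IsPartialPerm n S) :
    #(extensions n S 1) = 2 * (n - #S) + 1 := by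
  set R := range n \ S.image Prod.fst with hR
  set C := range n \ S.image Prod.snd with hC
  have hnR : n ∉ R := by simp [hR]
  have hnC : n ∉ C := by simp [hC]
  have hin : ∀ p ∈ (insert n R) ×ˢ {n} ∪ {n} ×ˢ C, (p.1 = n ∨ p.2 = n) ∧ p.1 < n + 1 ∧
      p.2 < n + 1 ∧ p.1 ∉ S.image Prod.fst ∧ p.2 ∉ S.image Prod.snd := by
    rintro ⟨a, b⟩ hp
    rw [mem_union, mem_product, mem_product, mem_insert, mem_singleton, mem_singleton,
      hR, hC, mem_sdiff, mem_sdiff, Finset.mem_range, Finset.mem_range] at hp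
    have h1 := hS.fst_notMem_image
    have h2 := hS.snd_notMem_image
    rcases hp with ⟨rfl | h, h'⟩ | ⟨h, h'⟩
    · dsimp only at h' ⊢
      subst h'
      exact ⟨Or.inl rfl, by omega, by omega, h1, h2⟩
    · dsimp only at h h' ⊢
      subst h'
      exact ⟨Or.inr rfl, by omega, by omega, h.2, h2⟩
    · dsimp only at h h' ⊢
      subst h
      exact ⟨Or.inl rfl, by omega, by omega, h1, h'.2⟩
  have hnotin : ∀ p ∈ (insert n R) ×ˢ {n} ∪ {n} ×ˢ C, p ∉ S := fun p hp hpS =>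
    (hin p hp).2.2.2.1 (mem_image_of_mem _ hpS)
  have himg : extensions n S 1 =
      ((insert n R) ×ˢ {n} ∪ {n} ×ˢ C).image (fun p => insert p S) := by
    ext T
    rw [mem_image]
    constructor
    · intro h
      obtain ⟨p, hp⟩ := card_eq_one.1 (card_sdiff_of_mem_extensions h)
      have hsub := subset_of_mem_extensions h
      obtain ⟨hT, hr, -⟩ := mem_extensions.1 h
      have hTp : insert p S = T := by
        rw [← sdiff_union_of_subset hsub, hp]; rfl
      have hmem : p ∈ T \ restrict n T := by rw [hr, hp]; exact mem_singleton_self p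
      obtain ⟨h1, h2, h3, h4, h5⟩ := hT.of_mem_sdiff hmem
      rw [hr] at h4 h5
      refine ⟨p, ?_, hTp⟩
      rw [mem_union, mem_product, mem_product, mem_insert, mem_singleton, mem_singleton,
        hR, hC, mem_sdiff, mem_sdiff, Finset.mem_range, Finset.mem_range]
      rcases eq_or_ne p.1 n with h6 | h6 <;> rcases eq_or_ne p.2 n with h7 | h7
      · exact Or.inl ⟨Or.inl h6, h7⟩
      · exact Or.inr ⟨h6, by omega, h5⟩
      · exact Or.inl ⟨Or.inr ⟨by omega, h4⟩, h7⟩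
      · omega
    · rintro ⟨p, hp, rfl⟩
      obtain ⟨h1, h2, h3, h4, h5⟩ := hin p hp
      exact mem_extensions.2 ⟨(hS.mono (Nat.le_succ n)).insert h2 h3 h4 h5,
        (restrict_insert h1 S).trans hS.restrict_eq, card_insert_of_notMem (hnotin p hp)⟩
  rw [himg, card_image_of_injOn, card_union_of_disjoint, card_product, card_product,
    card_insert_of_notMem hnR, hR, hC, hS.card_free_fst, hS.card_free_snd, card_singleton]
  · ring
  · rw [disjoint_left]
    rintro p hp hp'
    rw [mem_product, mem_singleton] at hp hp'
    exact hnC (hp.2 ▸ hp'.2)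
  · intro p hp p' _ hpp
    have : p ∈ insert p' S := by
      dsimp only at hpp
      rw [← hpp]
      exact mem_insert_self p S
    exact (mem_insert.1 this).resolve_right (hnotin p hp)

/-- Two new pairs exclude (n, n), so they are (a, n) and (n, b) with a and b chosen independently
among the free elements. -/
lemma card_extensions_two {n : ℕ} {S : Finset (ℕ × ℕ)} (hS : IsPartialPerm n S) :
    #(extensions n S 2) = (n - #S) ^ 2 := by
  set R := range n \ S.image Prod.fst with hR
  set C := range n \ S.image Prod.snd with hC
  have h1 := hS.fst_notMem_image
  have h2 := hS.snd_notMem_image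
  have himg : extensions n S 2 =
      (R ×ˢ C).image (fun p => insert (p.1, n) (insert (n, p.2) S)) := by
    ext T
    rw [mem_image]
    constructor
    · intro h
      have key : ∃ a b, a ≠ n ∧ b ≠ n ∧ T \ S = {(a, n), (n, b)} := by
        obtain ⟨p, p', hne, hp⟩ := card_eq_two.1 (card_sdiff_of_mem_extensions h)
        obtain ⟨hT, hr, -⟩ := mem_extensions.1 h
        have hp1 : p ∈ T \ S := by rw [hp]; exact mem_insert_self _ _
        have hp2 : p' ∈ T \ S := by rw [hp]; simp
        have hi := hT.2 p (mem_sdiff.1 hp1).1 p' (mem_sdiff.1 hp2).1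
        have hne' : p.1 ≠ p'.1 := fun h => hne (Prod.ext h (hi.1 h))
        have hne'' : p.2 ≠ p'.2 := fun h => hne (Prod.ext (hi.2 h) h)
        rw [← hr] at hp1 hp2
        obtain ⟨-, -, h3, -⟩ := hT.of_mem_sdiff hp1
        obtain ⟨-, -, h4, -⟩ := hT.of_mem_sdiff hp2
        obtain ⟨a, b⟩ := p
        obtain ⟨a', b'⟩ := p'
        dsimp only at h3 h4 hne' hne''
        rcases eq_or_ne a n with rfl | h5
        · obtain rfl : b' = a := h4.resolve_left hne'.symm
          exact ⟨a', b, hne'.symm, hne'', by rw [hp, Finset.pair_comm]⟩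
        · obtain rfl : b = n := h3.resolve_left h5
          obtain rfl : a' = b := h4.resolve_right hne''.symm
          exact ⟨a, b', h5, hne''.symm, hp⟩
      obtain ⟨a, b, ha, hb, hab⟩ := key
      have hsub := subset_of_mem_extensions h
      obtain ⟨hT, hr, -⟩ := mem_extensions.1 h
      have hp1 : (a, n) ∈ T \ restrict n T := by rw [hr, hab]; exact mem_insert_self _ _
      have hp2 : (n, b) ∈ T \ restrict n T := by rw [hr, hab]; simp
      obtain ⟨h3, -, -, h4, -⟩ := hT.of_mem_sdiff hp1
      obtain ⟨-, h5, -, -, h6⟩ := hT.of_mem_sdiff hp2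
      rw [hr] at h4 h6
      refine ⟨(a, b), ?_, ?_⟩
      · rw [mem_product, hR, hC, mem_sdiff, mem_sdiff, Finset.mem_range, Finset.mem_range]
        exact ⟨⟨lt_of_le_of_ne h3 ha, h4⟩, ⟨lt_of_le_of_ne h5 hb, h6⟩⟩
      · rw [← sdiff_union_of_subset hsub, hab, insert_union, singleton_union]
    · rintro ⟨⟨a, b⟩, hp, rfl⟩
      rw [mem_product, hR, hC, mem_sdiff, mem_sdiff, Finset.mem_range, Finset.mem_range] at hp
      dsimp only at hp ⊢
      obtain ⟨⟨ha, ha'⟩, hb, hb'⟩ := hp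
      have hS' := (hS.mono (Nat.le_succ n)).insert (Nat.lt_succ_self n) (by omega : b < n + 1)
        h1 hb'
      have hb'' : (n, b) ∉ S := fun h => h1 (mem_image_of_mem Prod.fst h)
      have ha'' : (a, n) ∉ insert (n, b) S := by
        rw [mem_insert, not_or, Prod.mk.injEq]
        exact ⟨by omega, fun h => h2 (mem_image_of_mem Prod.snd h)⟩
      refine mem_extensions.2 ⟨hS'.insert (by omega) (Nat.lt_succ_self n) ?_ ?_, ?_, ?_⟩
      · rw [image_insert, mem_insert, not_or]
        exact ⟨by dsimp only; omega, ha'⟩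
      · rw [image_insert, mem_insert, not_or]
        exact ⟨by dsimp only; omega, h2⟩
      · exact (restrict_insert (Or.inr rfl) _).trans
          ((restrict_insert (Or.inl rfl) S).trans hS.restrict_eq)
      · rw [card_insert_of_notMem ha'', card_insert_of_notMem hb'']
  rw [himg, card_image_of_injOn, card_product, hR, hC, hS.card_free_fst, hS.card_free_snd, sq]
  rintro ⟨a, b⟩ hp ⟨a', b'⟩ hp' hpp
  rw [mem_coe, mem_product, hR, hC, mem_sdiff, mem_sdiff, Finset.mem_range,
    Finset.mem_range] at hp hp'
  dsimp only at hp hp' hpp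
  have m1 : (a, n) ∈ insert (a', n) (insert (n, b') S) := by
    rw [← hpp]; exact mem_insert_self _ _
  have m2 : (n, b) ∈ insert (a', n) (insert (n, b') S) := by
    rw [← hpp]; exact mem_insert_of_mem (mem_insert_self _ _)
  simp only [mem_insert, Prod.mk.injEq] at m1 m2
  have h3 : (a, n) ∉ S := fun h => h2 (mem_image_of_mem Prod.snd h)
  have h4 : (n, b) ∉ S := fun h => h1 (mem_image_of_mem Prod.fst h)
  have h5 := hp.1.1
  have h6 := hp'.1.1
  have h7 := hp.2.1
  have h8 := hp'.2.1
  rw [Prod.mk.injEq]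
  constructor
  · rcases m1 with m | m | m
    · exact m.1
    · omega
    · exact absurd m h3
  · rcases m2 with m | m | m
    · omega
    · exact m.2
    · exact absurd m h4

/-- Every new pair has n as a coordinate, and each coordinate takes the value n at most once. -/
lemma card_extensions_of_two_lt {n k : ℕ} (S : Finset (ℕ × ℕ)) (hk : 2 < k) :
    #(extensions n S k) = 0 := by
  rw [card_eq_zero, eq_empty_iff_forall_notMem]
  intro T h
  have hc := card_sdiff_of_mem_extensions h
  obtain ⟨hT, hr, -⟩ := mem_extensions.1 h
  have hsub : T \ S ⊆ {p ∈ T | p.1 = n} ∪ {p ∈ T | p.2 = n} := by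
    intro p hp
    have hpT := (mem_sdiff.1 hp).1
    rw [← hr] at hp
    rw [mem_union, mem_filter, mem_filter]
    rcases (hT.of_mem_sdiff hp).2.2.1 with h | h
    · exact Or.inl ⟨hpT, h⟩
    · exact Or.inr ⟨hpT, h⟩
  have c1 : #{p ∈ T | p.1 = n} ≤ 1 := by
    rw [card_le_one]
    intro p hp p' hp'
    rw [mem_filter] at hp hp'
    have := hp.2.trans hp'.2.symm
    exact Prod.ext this ((hT.2 p hp.1 p' hp'.1).1 this)
  have c2 : #{p ∈ T | p.2 = n} ≤ 1 := by
    rw [card_le_one]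
    intro p hp p' hp'
    rw [mem_filter] at hp hp'
    have := hp.2.trans hp'.2.symm
    exact Prod.ext ((hT.2 p hp.1 p' hp'.1).2 this) this
  have := card_le_card hsub
  have := card_union_le {p ∈ T | p.1 = n} {p ∈ T | p.2 = n}
  omega

/-- The number of ways to pass from defect `h` to defect `h'`. -/
def weight (h h' : ℕ) : ℕ :=
  if h' = h + 1 then 1 else if h' = h then 2 * h + 1 else if h' + 1 = h then h ^ 2 else 0

/-- Adding k pairs while the order grows by one changes the defect d into d + 1 - k, so the target
defect determines k. -/
lemma card_extensions_defect {n : ℕ} {S : Finset (ℕ × ℕ)} (hS : IsPartialPerm n S) (h' : ℕ) :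
    #{T ∈ partialPerms (n + 1) | restrict n T = S ∧ defect T (n + 1) = h'} =
      weight (defect S n) h' := by
  have hle := hS.card_le
  rw [hS.defect_self]
  have hsub : ∀ T, restrict n T = S → #S ≤ #T := by
    rintro T rfl
    exact card_le_card (filter_subset _ _)
  have hrew : ∀ T ∈ partialPerms (n + 1), defect T (n + 1) = n + 1 - #T ∧ #T ≤ n + 1 := by
    intro T hT
    rw [mem_partialPerms] at hT
    exact ⟨hT.defect_self, hT.card_le⟩
  rcases Nat.lt_or_ge (n + 1 - #S) h' with hlt | hge
  · rw [weight, if_neg (by omega), if_neg (by omega), if_neg (by omega), card_eq_zero,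
      filter_eq_empty_iff]
    rintro T hT ⟨h1, h2⟩
    have := hrew T hT
    have := hsub T h1
    omega
  · obtain ⟨k, hk⟩ := Nat.exists_eq_add_of_le hge
    have : ({T ∈ partialPerms (n + 1) | restrict n T = S ∧ defect T (n + 1) = h'}) =
        extensions n S k := by
      rw [extensions]
      refine filter_congr fun T hT => and_congr_right fun h1 => ?_
      have := hrew T hT
      have := hsub T h1
      omega
    rw [this]
    obtain rfl | rfl | rfl | h3 : k = 0 ∨ k = 1 ∨ k = 2 ∨ 2 < k := by omega
    · rw [card_extensions_zero hS, weight, if_pos (by omega)]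
    · rw [card_extensions_one hS, weight, if_neg (by omega), if_pos (by omega)]
    · rw [card_extensions_two hS, weight, if_neg (by omega), if_neg (by omega),
        if_pos (by omega)]
    · rw [card_extensions_of_two_lt S h3, weight, if_neg (by omega), if_neg (by omega),
        if_neg (by omega)]

/-! ### Counting by defect profile -/

open Classical in
/-- The partial permutations of order `n` whose defect sequence has no two consecutive zeros,
excess `e`, and `q` zeros after the initial one. -/
noncomputable def profileClass (n e q : ℕ) : Finset (Finset (ℕ × ℕ)) :=
  {S ∈ partialPerms n | Sparse n (defect S) ∧ excess n (defect S) = e ∧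
    numZeros n (defect S) = q}

/-- The number of partial permutations in `profileClass n e q` with final defect `h`. -/
noncomputable def profileCount (n e q h : ℕ) : ℕ := #{S ∈ profileClass n e q | defect S n = h}

lemma mem_profileClass {n e q : ℕ} {S : Finset (ℕ × ℕ)} : S ∈ profileClass n e q ↔
    IsPartialPerm n S ∧ Sparse n (defect S) ∧ excess n (defect S) = e ∧
      numZeros n (defect S) = q := by
  simp only [profileClass, mem_filter, mem_partialPerms]

lemma sparse_succ (n : ℕ) (h : ℕ → ℕ) :
    Sparse (n + 1) h ↔ Sparse n h ∧ ¬ (h n = 0 ∧ h (n + 1) = 0) := by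
  simp only [Sparse, Nat.lt_succ_iff_lt_or_eq, or_imp, forall_and, forall_eq]

lemma excess_succ (n : ℕ) (h : ℕ → ℕ) : excess (n + 1) h = excess n h + (h (n + 1) - 1) :=
  Finset.sum_range_succ _ _

lemma numZeros_succ (n : ℕ) (h : ℕ → ℕ) :
    numZeros (n + 1) h = numZeros n h + if h (n + 1) = 0 then 1 else 0 :=
  Finset.sum_range_succ _ _

lemma sparse_congr {n : ℕ} {h h' : ℕ → ℕ} (H : ∀ i ≤ n, h i = h' i) :
    Sparse n h ↔ Sparse n h' := by
  refine forall₂_congr fun i hi => ?_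
  rw [H i hi.le, H (i + 1) hi]

lemma excess_congr {n : ℕ} {h h' : ℕ → ℕ} (H : ∀ i ≤ n, h i = h' i) :
    excess n h = excess n h' :=
  Finset.sum_congr rfl fun i hi => by rw [H (i + 1) (Finset.mem_range.1 hi)]

lemma numZeros_congr {n : ℕ} {h h' : ℕ → ℕ} (H : ∀ i ≤ n, h i = h' i) :
    numZeros n h = numZeros n h' :=
  Finset.sum_congr rfl fun i hi => by rw [H (i + 1) (Finset.mem_range.1 hi)]

lemma restrict_mem_profileClass {n e q : ℕ} {T : Finset (ℕ × ℕ)} :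
    restrict n T ∈ profileClass n e q ↔ IsPartialPerm n (restrict n T) ∧ Sparse n (defect T) ∧
      excess n (defect T) = e ∧ numZeros n (defect T) = q := by
  have H : ∀ i ≤ n, defect (restrict n T) i = defect T i := fun i hi => defect_restrict hi T
  rw [mem_profileClass, sparse_congr H, excess_congr H, numZeros_congr H]

lemma profileCount_zero (e q h : ℕ) :
    profileCount 0 e q h = if e = 0 ∧ q = 0 ∧ h = 0 then 1 else 0 := by
  have h0 : ∀ S : Finset (ℕ × ℕ), IsPartialPerm 0 S ↔ S = ∅ := by
    intro S
    rw [eq_empty_iff_forall_notMem]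
    refine ⟨fun h p hp => absurd (h.1 p hp).1 (Nat.not_lt_zero _), fun h => ⟨?_, ?_⟩⟩ <;>
    exact fun p hp => absurd hp (h p)
  have h1 : ∀ S : Finset (ℕ × ℕ), S ∈ ({S ∈ profileClass 0 e q | defect S 0 = h}) ↔
      S = ∅ ∧ e = 0 ∧ q = 0 ∧ h = 0 := by
    intro S
    rw [mem_filter, mem_profileClass, h0]
    simp only [Sparse, excess, numZeros, defect, Finset.range_zero, Finset.sum_empty,
      Nat.zero_sub, Nat.not_lt_zero, false_imp_iff, forall_const]
    constructor
    · rintro ⟨⟨h1, -, h2, h3⟩, h4⟩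
      exact ⟨h1, h2.symm, h3.symm, h4.symm⟩
    · rintro ⟨h1, h2, h3, h4⟩
      exact ⟨⟨h1, trivial, h2.symm, h3.symm⟩, h4.symm⟩
  rw [profileCount]
  split_ifs with hc
  · rw [card_eq_one]
    exact ⟨∅, by ext S; rw [h1, mem_singleton]; tauto⟩
  · rw [card_eq_zero, eq_empty_iff_forall_notMem]
    intro S hS
    exact hc ((h1 S).1 hS).2

/-- The number of ways to pass from defect `h` to defect `h'`, avoiding two consecutive zeros. -/
def sparseWeight (h h' : ℕ) : ℕ := if h = 0 ∧ h' = 0 then 0 else weight h h'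

/-- Restriction to order n forgets the last step; its fibres are counted by
`card_extensions_defect`. The last defect h' adds h' - 1 to the excess, which truncates to 0 when h'
= 0. -/
lemma profileCount_succ_eq_sum_class (n e q h' : ℕ) :
    profileCount (n + 1) (e + (h' - 1)) (q + if h' = 0 then 1 else 0) h' =
      ∑ S ∈ profileClass n e q, sparseWeight (defect S n) h' := by
  have hmem : ∀ T, T ∈ ({T ∈ profileClass (n + 1) (e + (h' - 1)) (q + if h' = 0 then 1 else 0) |
      defect T (n + 1) = h'}) ↔ IsPartialPerm (n + 1) T ∧ restrict n T ∈ profileClass n e q ∧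
      ¬ (defect T n = 0 ∧ h' = 0) ∧ defect T (n + 1) = h' := by
    intro T
    rw [mem_filter, mem_profileClass, restrict_mem_profileClass, sparse_succ, excess_succ,
      numZeros_succ]
    constructor
    · rintro ⟨⟨h1, ⟨h2, h3⟩, h4, h5⟩, rfl⟩
      exact ⟨h1, ⟨h1.restrict n, h2, by omega, by omega⟩, h3, rfl⟩
    · rintro ⟨h1, ⟨-, h2, rfl, rfl⟩, h3, rfl⟩
      exact ⟨⟨h1, ⟨h2, h3⟩, rfl, rfl⟩, rfl⟩
  rw [profileCount, card_eq_sum_card_fiberwise (f := restrict n) (t := profileClass n e q)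
    fun T hT => ((hmem T).1 hT).2.1]
  refine Finset.sum_congr rfl fun S hS => ?_
  have hSp := (mem_profileClass.1 hS).1
  rw [sparseWeight]
  by_cases h0 : defect S n = 0 ∧ h' = 0
  · rw [if_pos h0, card_eq_zero, filter_eq_empty_iff]
    rintro T hT rfl
    rw [defect_restrict le_rfl] at h0
    exact ((hmem T).1 hT).2.2.1 h0
  · rw [if_neg h0, ← card_extensions_defect hSp]
    congr 1
    ext T
    rw [mem_filter, hmem, mem_filter, mem_partialPerms]
    constructor
    · rintro ⟨⟨h1, -, -, h2⟩, h3⟩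
      exact ⟨h1, h3, h2⟩
    · rintro ⟨h1, rfl, h2⟩
      rw [defect_restrict le_rfl] at h0
      exact ⟨⟨h1, hS, h0, h2⟩, rfl⟩

lemma sum_comp_eq_sum_range {α : Type*} (A : Finset α) (f : ℕ → ℕ) (d : α → ℕ) (N : ℕ)
    (hf : ∀ h, N ≤ h → f h = 0) :
    ∑ S ∈ A, f (d S) = ∑ h ∈ range N, f h * #{S ∈ A | d S = h} := by
  simp only [card_filter, mul_sum]
  rw [sum_comm]
  refine Finset.sum_congr rfl fun S _ => ?_
  simp only [mul_ite, mul_one, mul_zero, Finset.sum_ite_eq, Finset.mem_range]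
  split_ifs with h
  · rfl
  · exact hf _ (not_lt.1 h)

lemma profileCount_succ (n e q h' : ℕ) :
    profileCount (n + 1) (e + (h' - 1)) (q + if h' = 0 then 1 else 0) h' =
      ∑ h ∈ range (h' + 2), sparseWeight h h' * profileCount n e q h := by
  rw [profileCount_succ_eq_sum_class]
  -- The defect drops by at most one in a step, so only h ≤ h' + 1 contributes.
  refine sum_comp_eq_sum_range _ (fun h => sparseWeight h h') _ _ fun h hh => ?_
  rw [sparseWeight, if_neg (by omega), weight, if_neg (by omega), if_neg (by omega),
    if_neg (by omega)]

lemma profileCount_succ_zero_zero (n e : ℕ) : profileCount (n + 1) e 0 0 = 0 := by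
  rw [profileCount, card_eq_zero, filter_eq_empty_iff]
  intro T hT h
  have := (mem_profileClass.1 hT).2.2.2
  rw [numZeros_succ, if_pos h] at this
  omega

lemma profileCount_eq_zero_of_lt {n e q h : ℕ} (hh : e + 1 < h) : profileCount n e q h = 0 := by
  cases n with
  | zero => rw [profileCount_zero, if_neg (by omega)]
  | succ n =>
    rw [profileCount, card_eq_zero, filter_eq_empty_iff]
    intro T hT h
    have := (mem_profileClass.1 hT).2.2.1
    rw [excess_succ, h] at this
    omega

lemma profileCount_succ_zero (n e q : ℕ) :
    profileCount (n + 1) e (q + 1) 0 = profileCount n e q 1 := by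
  have := profileCount_succ n e q 0
  simpa [Finset.sum_range_succ, sparseWeight, weight] using this

lemma profileCount_succ_one (n e q : ℕ) : profileCount (n + 1) e q 1 =
    profileCount n e q 0 + 3 * profileCount n e q 1 + 4 * profileCount n e q 2 := by
  have := profileCount_succ n e q 1
  simpa [Finset.sum_range_succ, sparseWeight, weight] using this

/-- A final defect 3 already uses excess 2, leaving excess 0 before it; but the preceding defect
must be at least 2. -/
lemma profileCount_three {n e q : ℕ} (he : e ≤ 2) : profileCount n e q 3 = 0 := by
  rcases Nat.lt_or_ge e 2 with h | h
  · exact profileCount_eq_zero_of_lt (by omega)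
  obtain rfl : e = 2 := by omega
  cases n with
  | zero => rw [profileCount_zero, if_neg (by omega)]
  | succ n =>
    have := profileCount_succ n 0 q 3
    simpa [Finset.sum_range_succ, sparseWeight, weight,
      profileCount_eq_zero_of_lt (n := n) (e := 0) (q := q)] using this

lemma profileCount_succ_two {n e q : ℕ} (he : e ≤ 2) : profileCount (n + 1) (e + 1) q 2 =
    profileCount n e q 1 + 5 * profileCount n e q 2 := by
  have := profileCount_succ n e q 2
  simpa [Finset.sum_range_succ, sparseWeight, weight, profileCount_three he] using this

/-! ### From permutations to full partial permutations -/

/-- The graph of a permutation. -/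
def graph {m : ℕ} (σ : Equiv.Perm (Fin m)) : Finset (ℕ × ℕ) :=
  univ.image fun i : Fin m => ((i : ℕ), (σ i : ℕ))

lemma mem_graph {m : ℕ} {σ : Equiv.Perm (Fin m)} {p : ℕ × ℕ} :
    p ∈ graph σ ↔ ∃ i : Fin m, ((i : ℕ), (σ i : ℕ)) = p := by
  simp [graph]

lemma graph_injective (m : ℕ) : Function.Injective (graph (m := m)) := by
  intro σ τ h
  ext i
  have hi : ((i : ℕ), (σ i : ℕ)) ∈ graph τ := h ▸ mem_graph.2 ⟨i, rfl⟩
  obtain ⟨j, hj⟩ := mem_graph.1 hi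
  rw [Prod.mk.injEq] at hj
  rw [← hj.2, Fin.ext hj.1]

lemma card_graph {m : ℕ} (σ : Equiv.Perm (Fin m)) : #(graph σ) = m := by
  rw [graph, card_image_of_injective, card_univ, Fintype.card_fin]
  intro i j h
  exact Fin.ext (Prod.mk.inj h).1

lemma isPartialPerm_graph {m : ℕ} (σ : Equiv.Perm (Fin m)) : IsPartialPerm m (graph σ) := by
  constructor
  · intro p hp
    obtain ⟨i, rfl⟩ := mem_graph.1 hp
    exact ⟨i.isLt, (σ i).isLt⟩
  · intro p hp p' hp'
    obtain ⟨i, rfl⟩ := mem_graph.1 hp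
    obtain ⟨j, rfl⟩ := mem_graph.1 hp'
    dsimp only
    rw [← Fin.ext_iff, ← Fin.ext_iff, σ.injective.eq_iff]

lemma defect_graph {m n : ℕ} (σ : Equiv.Perm (Fin m)) (hn : n ≤ m) :
    defect (graph σ) n = height ⟨m, σ⟩ n := by
  have h1 : #(restrict n (graph σ)) =
      ∑ i : Fin m, if (i : ℕ) < n ∧ (σ i : ℕ) < n then 1 else 0 := by
    rw [restrict, graph, filter_image, card_image_of_injective, card_filter]
    intro i j h
    exact Fin.ext (Prod.mk.inj h).1
  have h2 : ∑ i : Fin m, (if (i : ℕ) < n then 1 else 0) = n := by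
    rw [Fin.sum_univ_eq_sum_range (fun i => if i < n then 1 else 0) m, ← card_filter]
    have : (range m).filter (· < n) = range n := by
      ext i
      simp only [mem_filter, Finset.mem_range]
      omega
    rw [this, card_range]
  have h3 : ∑ i : Fin m, (if (i : ℕ) < n then 1 else 0) = height ⟨m, σ⟩ n +
      ∑ i : Fin m, if (i : ℕ) < n ∧ (σ i : ℕ) < n then 1 else 0 := by
    rw [height, ← Finset.sum_add_distrib]
    refine Finset.sum_congr rfl fun i _ => ?_
    dsimp only
    split_ifs <;> omega
  rw [defect]
  omega

lemma exists_graph_eq {m : ℕ} {S : Finset (ℕ × ℕ)} (hS : IsPartialPerm m S) (hd : defect S m = 0) :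
    ∃ σ : Equiv.Perm (Fin m), graph σ = S := by
  have hcard : #S = m := by
    rw [hS.defect_self] at hd
    have := hS.card_le
    omega
  have himg : S.image Prod.fst = range m :=
    eq_of_subset_of_card_le hS.image_fst_subset (by rw [hS.card_image_fst, hcard, card_range])
  have hex : ∀ i : Fin m, ∃ j : Fin m, ((i : ℕ), (j : ℕ)) ∈ S := by
    intro i
    have hi : (i : ℕ) ∈ S.image Prod.fst := by
      rw [himg]
      exact Finset.mem_range.2 i.isLt
    obtain ⟨⟨a, b⟩, hp, rfl⟩ := mem_image.1 hi
    exact ⟨⟨b, (hS.1 _ hp).2⟩, hp⟩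
  choose f hf using hex
  have hinj : Function.Injective f := fun i j hij =>
    Fin.ext ((hS.2 _ (hf i) _ (hf j)).2 (by rw [hij]))
  refine ⟨Equiv.ofBijective f (Finite.injective_iff_bijective.1 hinj),
    eq_of_subset_of_card_le ?_ (by rw [card_graph, hcard])⟩
  intro p hp
  obtain ⟨i, rfl⟩ := mem_graph.1 hp
  exact hf i

/-- Permutations correspond to partial permutations of final defect 0 through their graphs, with
heights becoming defects. Given q, the hypothesis on m and e turns the ℓ₁ condition into an excess
condition by `sum_add_numZeros`. -/
lemma beta_eq_profileCount {k m q e : ℕ} (h : m + e = k + q) :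
    beta (2 * k) m q = profileCount m e q 0 := by
  have key : ∀ σ : Equiv.Perm (Fin m),
      (IsSplitType ⟨m, σ⟩ ∧ l1 σ = 2 * k ∧ HasNumParts ⟨m, σ⟩ q) ↔
        graph σ ∈ ({S ∈ profileClass m e q | defect S m = 0}) := by
    intro σ
    have H : ∀ i ≤ m, defect (graph σ) i = height ⟨m, σ⟩ i := fun i hi => defect_graph σ hi
    rw [mem_filter, mem_profileClass, sparse_congr H, excess_congr H, numZeros_congr H,
      H m le_rfl, isSplitType_iff, hasNumParts_iff, l1_eq]
    have h1 := sum_add_numZeros m (height ⟨m, σ⟩)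
    have h2 := height_self ⟨m, σ⟩
    have h3 := isPartialPerm_graph σ
    dsimp only at h2 ⊢
    constructor
    · rintro ⟨h4, h5, h6⟩
      exact ⟨⟨h3, h4, by omega, h6⟩, h2⟩
    · rintro ⟨⟨-, h4, h5, h6⟩, -⟩
      exact ⟨h4, by omega, h6⟩
  rw [beta, profileCount, ← Nat.card_eq_finsetCard]
  refine Nat.card_eq_of_bijective (fun σ => ⟨graph σ.1, (key σ.1).1 σ.2⟩) ⟨?_, ?_⟩
  · intro σ τ hστ
    exact Subtype.ext (graph_injective m (Subtype.ext_iff.1 hστ))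
  · rintro ⟨S, hS⟩
    have hS' := mem_filter.1 hS
    obtain ⟨σ, rfl⟩ := exists_graph_eq (mem_profileClass.1 hS'.1).1 hS'.2
    exact ⟨⟨σ, (key σ).2 hS⟩, rfl⟩

/-! ### Generating functions -/

section Series

open PowerSeries

/-- The generating function of `profileCount n e q h` in `n`. -/
noncomputable def profileSeries (h e q : ℕ) : ℚ⟦X⟧ :=
  PowerSeries.mk fun n => (profileCount n e q h : ℚ)

/-- The power series `1 / (1 - 3 X)`. -/
noncomputable def geomThree : ℚ⟦X⟧ := PowerSeries.mk fun n => (3 : ℚ) ^ n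

lemma geomThree_mul : geomThree * (1 - 3 * X) = 1 := by
  ext n
  have h3 : (3 : ℚ⟦X⟧) = C (3 : ℚ) := (map_ofNat C 3).symm
  rw [mul_sub, mul_one, mul_left_comm, h3, map_sub, coeff_C_mul]
  cases n with
  | zero => simp [geomThree]
  | succ n => simp [geomThree, coeff_succ_mul_X, coeff_one, pow_succ']

lemma geomThree_pow (b : ℕ) : geomThree ^ (b + 1) =
    PowerSeries.mk fun n => ((n + b).choose b : ℚ) * 3 ^ n := by
  have h : geomThree = rescale (3 : ℚ) (PowerSeries.mk 1) := by
    ext n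
    simp [geomThree]
  rw [h, ← map_pow, PowerSeries.mk_one_pow_eq_mk_choose_add, rescale_mk]
  ext n
  simp [mul_comm, add_comm]

lemma coeff_X_pow_mul_geomThree_pow_of_lt {n a : ℕ} (b : ℕ) (h : n < a) :
    coeff n (X ^ a * geomThree ^ b) = 0 := by
  rw [coeff_X_pow_mul', if_neg (by omega)]

/-- Here r = n - a + b. If n < a then r < b and the binomial vanishes, so the negative exponent of 3
is harmless. -/
lemma coeff_X_pow_mul_geomThree_pow {n a b r : ℕ} (h : a + r = n + b) :
    coeff n (X ^ a * geomThree ^ (b + 1)) = (r.choose b : ℚ) * 3 ^ ((n : ℤ) - a) := by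
  rw [coeff_X_pow_mul']
  split_ifs with hle
  · obtain ⟨j, rfl⟩ := Nat.exists_eq_add_of_le hle
    obtain rfl : r = j + b := by omega
    rw [geomThree_pow, coeff_mk, Nat.add_sub_cancel_left]
    push_cast
    rw [add_sub_cancel_left, zpow_natCast]
  · rw [Nat.choose_eq_zero_of_lt (by omega)]
    simp

lemma profileSeries_zero_zero (e : ℕ) :
    profileSeries 0 e 0 = if e = 0 then 1 else 0 := by
  ext n
  rw [profileSeries, coeff_mk]
  cases n with
  | zero =>
    rw [profileCount_zero]
    split_ifs <;> simp_all
  | succ n =>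
    rw [profileCount_succ_zero_zero]
    split_ifs <;> simp [coeff_one]

lemma profileSeries_zero_succ (e q : ℕ) :
    profileSeries 0 e (q + 1) = X * profileSeries 1 e q := by
  ext n
  cases n with
  | zero => simp [profileSeries, profileCount_zero]
  | succ n => simp [profileSeries, coeff_succ_X_mul, profileCount_succ_zero]

lemma profileSeries_one_eq (e q : ℕ) : profileSeries 1 e q =
    X * (profileSeries 0 e q + 3 * profileSeries 1 e q + 4 * profileSeries 2 e q) := by
  have h3 : (3 : ℚ⟦X⟧) = C (3 : ℚ) := (map_ofNat C 3).symm
  have h4 : (4 : ℚ⟦X⟧) = C (4 : ℚ) := (map_ofNat C 4).symm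
  ext n
  cases n with
  | zero => simp [profileSeries, profileCount_zero]
  | succ n =>
    rw [h3, h4, coeff_succ_X_mul, map_add, map_add, coeff_C_mul, coeff_C_mul]
    simp [profileSeries, profileCount_succ_one]

lemma profileSeries_two_zero (q : ℕ) : profileSeries 2 0 q = 0 := by
  ext n
  simp [profileSeries, profileCount_eq_zero_of_lt]

lemma profileSeries_two_succ_eq {e : ℕ} (he : e ≤ 2) (q : ℕ) : profileSeries 2 (e + 1) q =
    X * (profileSeries 1 e q + 5 * profileSeries 2 e q) := by
  have h5 : (5 : ℚ⟦X⟧) = C (5 : ℚ) := (map_ofNat C 5).symm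
  ext n
  cases n with
  | zero => simp [profileSeries, profileCount_zero]
  | succ n =>
    rw [h5, coeff_succ_X_mul, map_add, coeff_C_mul]
    simp [profileSeries, profileCount_succ_two he]

/-- The stay at height 1, of weight 3, is summed as a geometric series, which eliminates this series
from the recursion. -/
lemma profileSeries_one (e q : ℕ) : profileSeries 1 e q =
    X * geomThree * (profileSeries 0 e q + 4 * profileSeries 2 e q) := by
  linear_combination geomThree * profileSeries_one_eq e q - profileSeries 1 e q * geomThree_mul

/-- The generating function of the connected permutations of excess zero. -/
noncomputable def baseSeries : ℚ⟦X⟧ := X ^ 2 * geomThree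

lemma profileSeries_succ (e q : ℕ) : profileSeries 0 e (q + 1) =
    baseSeries * (profileSeries 0 e q + 4 * profileSeries 2 e q) := by
  rw [profileSeries_zero_succ, profileSeries_one, baseSeries]
  ring

lemma profileSeries_two_succ {e : ℕ} (he : e ≤ 2) (q : ℕ) : profileSeries 2 (e + 1) q =
    baseSeries * (profileSeries 0 e q + 4 * profileSeries 2 e q) +
      5 * X * profileSeries 2 e q := by
  rw [profileSeries_two_succ_eq he, profileSeries_one, baseSeries]
  ring

lemma profileSeries_excess_zero (q : ℕ) : profileSeries 0 0 q = baseSeries ^ q := by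
  induction q with
  | zero => simp [profileSeries_zero_zero]
  | succ q ih => rw [profileSeries_succ, ih, profileSeries_two_zero]; ring

lemma profileSeries_two_one (q : ℕ) : profileSeries 2 1 q = baseSeries ^ (q + 1) := by
  rw [profileSeries_two_succ (by omega), profileSeries_excess_zero, profileSeries_two_zero]
  ring

lemma profileSeries_excess_one (q : ℕ) :
    profileSeries 0 1 q = 4 * (q : ℚ⟦X⟧) * baseSeries ^ (q + 1) := by
  induction q with
  | zero => simp [profileSeries_zero_zero]
  | succ q ih => rw [profileSeries_succ, ih, profileSeries_two_one]; push_cast; ring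

lemma profileSeries_two_two (q : ℕ) : profileSeries 2 2 q =
    4 * ((q : ℚ⟦X⟧) + 1) * baseSeries ^ (q + 2) + 5 * X * baseSeries ^ (q + 1) := by
  rw [profileSeries_two_succ (by omega), profileSeries_excess_one, profileSeries_two_one]
  ring

lemma profileSeries_excess_two (q : ℕ) : profileSeries 0 2 q =
    8 * (q : ℚ⟦X⟧) * ((q : ℚ⟦X⟧) + 1) * baseSeries ^ (q + 2) +
      20 * (q : ℚ⟦X⟧) * X * baseSeries ^ (q + 1) := by
  induction q with
  | zero => simp [profileSeries_zero_zero]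
  | succ q ih => rw [profileSeries_succ, ih, profileSeries_two_two]; push_cast; ring

/-- The factor 3 clears the denominator of the coefficient 32/3, which arises from summing 32(q +
1)(q + 2) over q. -/
lemma three_mul_profileSeries_excess_three (q : ℕ) : 3 * profileSeries 0 3 q =
    32 * (q : ℚ⟦X⟧) * ((q : ℚ⟦X⟧) + 1) * ((q : ℚ⟦X⟧) + 2) * baseSeries ^ (q + 3) +
      240 * (q : ℚ⟦X⟧) * ((q : ℚ⟦X⟧) + 1) * X * baseSeries ^ (q + 2) +
      300 * (q : ℚ⟦X⟧) * X ^ 2 * baseSeries ^ (q + 1) := by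
  induction q with
  | zero => simp [profileSeries_zero_zero]
  | succ q ih =>
    rw [profileSeries_succ, profileSeries_two_succ (by omega), profileSeries_excess_two,
      profileSeries_two_two]
    push_cast
    linear_combination baseSeries * ih

lemma profileCount_excess_zero (n q : ℕ) :
    (profileCount n 0 q 0 : ℚ) = coeff n (X ^ (2 * q) * geomThree ^ q) := by
  have h := congrArg (coeff n) (profileSeries_excess_zero q)
  rw [profileSeries, coeff_mk] at h
  rw [h, baseSeries, mul_pow, pow_mul]

lemma profileCount_excess_one (n q : ℕ) : (profileCount n 1 q 0 : ℚ) =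
    4 * q * coeff n (X ^ (2 * q + 2) * geomThree ^ (q + 1)) := by
  have h := congrArg (coeff n) (profileSeries_excess_one q)
  have hC : (4 * q : ℚ⟦X⟧) = C (4 * q : ℚ) := by
    simp only [map_mul, map_ofNat, map_natCast]
  rw [profileSeries, coeff_mk, hC, coeff_C_mul] at h
  rw [h, baseSeries]
  ring_nf

lemma profileCount_excess_two (n q : ℕ) : (profileCount n 2 q 0 : ℚ) =
    8 * q * (q + 1) * coeff n (X ^ (2 * q + 4) * geomThree ^ (q + 2)) +
      20 * q * coeff n (X ^ (2 * q + 3) * geomThree ^ (q + 1)) := by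
  have h := congrArg (coeff n) (profileSeries_excess_two q)
  have hC : (8 * q * (q + 1) : ℚ⟦X⟧) = C (8 * q * (q + 1) : ℚ) := by
    simp only [map_mul, map_add, map_one, map_ofNat, map_natCast]
  have hC' : (20 * q : ℚ⟦X⟧) = C (20 * q : ℚ) := by
    simp only [map_mul, map_ofNat, map_natCast]
  rw [profileSeries, coeff_mk, hC, hC', mul_assoc (C _), map_add, coeff_C_mul,
    coeff_C_mul] at h
  rw [h, baseSeries]
  ring_nf

lemma profileCount_excess_three (n q : ℕ) : 3 * (profileCount n 3 q 0 : ℚ) =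
    32 * q * (q + 1) * (q + 2) * coeff n (X ^ (2 * q + 6) * geomThree ^ (q + 3)) +
      240 * q * (q + 1) * coeff n (X ^ (2 * q + 5) * geomThree ^ (q + 2)) +
      300 * q * coeff n (X ^ (2 * q + 4) * geomThree ^ (q + 1)) := by
  have h := congrArg (coeff n) (three_mul_profileSeries_excess_three q)
  have h3 : (3 : ℚ⟦X⟧) = C (3 : ℚ) := (map_ofNat C 3).symm
  have hC : (32 * q * (q + 1) * (q + 2) : ℚ⟦X⟧) = C (32 * q * (q + 1) * (q + 2) : ℚ) := by
    simp only [map_mul, map_add, map_one, map_ofNat, map_natCast]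
  have hC' : (240 * q * (q + 1) : ℚ⟦X⟧) = C (240 * q * (q + 1) : ℚ) := by
    simp only [map_mul, map_add, map_one, map_ofNat, map_natCast]
  have hC'' : (300 * q : ℚ⟦X⟧) = C (300 * q : ℚ) := by
    simp only [map_mul, map_ofNat, map_natCast]
  rw [profileSeries, hC, hC', hC'', h3, mul_assoc (C (240 * q * (q + 1) : ℚ)),
    mul_assoc (C (300 * q : ℚ)), map_add, map_add, coeff_C_mul, coeff_C_mul, coeff_C_mul,
    coeff_C_mul, coeff_mk] at h
  rw [h, baseSeries]
  ring_nf

end Series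

/-! ### Extracting the coefficients -/

lemma add_one_mul_choose_cast (r p : ℕ) :
    ((p : ℚ) + 1) * ((r + 1).choose (p + 1) : ℚ) = (r + 1) * (r.choose p : ℚ) := by
  have := Nat.add_one_mul_choose_eq r p
  have : ((r : ℚ) + 1) * (r.choose p : ℚ) = ((r + 1).choose (p + 1) : ℚ) * (p + 1) := by
    exact_mod_cast this
  linarith

lemma choose_succ_right_cast (r p : ℕ) :
    ((p : ℚ) + 1) * (r.choose (p + 1) : ℚ) = (r - p) * (r.choose p : ℚ) := by
  rcases Nat.lt_or_ge r p with h | h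
  · rw [Nat.choose_eq_zero_of_lt h, Nat.choose_eq_zero_of_lt (by omega)]
    simp
  · have := Nat.choose_succ_right_eq r p
    rw [← Nat.cast_sub h, mul_comm, mul_comm (_ : ℚ) (r.choose p : ℚ)]
    exact_mod_cast this

/-- At r = 0 the factor r cancels the effect of the truncated r - 1; this covers k = 6 in the
excess-two formula. -/
lemma natCast_mul_choose_pred (r p : ℕ) :
    (r : ℚ) * ((r - 1).choose p : ℚ) = (r - p) * (r.choose p : ℚ) := by
  cases r with
  | zero => cases p <;> simp
  | succ r =>
    rw [← choose_succ_right_cast, add_one_mul_choose_cast]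
    simp

lemma beta_excess_zero {k m q : ℕ} (hm : m = k + q) (hq : 1 ≤ q) (hqk : q ≤ k) :
    (beta (2 * k) m q : ℚ) = ((k - 1).choose (q - 1) : ℚ) * 3 ^ ((k : ℤ) - q) := by
  obtain ⟨p, rfl⟩ := Nat.exists_eq_add_of_le' hq
  rw [beta_eq_profileCount (e := 0) (by omega), profileCount_excess_zero,
    coeff_X_pow_mul_geomThree_pow (r := k - 1) (by omega), Nat.add_sub_cancel, hm]
  congr 2
  push_cast
  ring

lemma beta_excess_one {k m q : ℕ} (hm : m + 1 = k + q) (hq : 1 ≤ q) (hqk : q + 3 ≤ k) :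
    (beta (2 * k) m q : ℚ) =
      4 * ((k : ℚ) - 3) * ((k - 4).choose (q - 1) : ℚ) * 3 ^ ((k : ℤ) - q - 3) := by
  obtain ⟨p, rfl⟩ := Nat.exists_eq_add_of_le' hq
  obtain ⟨j, rfl⟩ := Nat.exists_eq_add_of_le' hqk
  rw [beta_eq_profileCount (e := 1) (by omega), profileCount_excess_one,
    coeff_X_pow_mul_geomThree_pow (r := j + p + 1) (by omega), Nat.add_sub_cancel]
  have hk : j + (p + 1 + 3) - 4 = j + p := by omega
  have hz : (m : ℤ) - (2 * (p + 1) + 2 : ℕ) = j := by omega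
  have hz' : ((j + (p + 1 + 3) : ℕ) : ℤ) - (p + 1 : ℕ) - 3 = j := by omega
  rw [hk, hz, hz']
  have h1 := add_one_mul_choose_cast (j + p) p
  push_cast at h1 ⊢
  linear_combination 4 * 3 ^ (j : ℤ) * h1

lemma beta_excess_two {k m q : ℕ} (hm : m + 2 = k + q) (hq : 1 ≤ q) (hqk : q + 5 ≤ k) :
    (beta (2 * k) m q : ℚ) = 4 * ((k : ℚ) - 5) *
      (2 * ((k : ℚ) - 6) * ((k - 7).choose (q - 1) : ℚ) +
        15 * ((k - 6).choose (q - 1) : ℚ)) * 3 ^ ((k : ℤ) - q - 6) := by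
  obtain ⟨p, rfl⟩ := Nat.exists_eq_add_of_le' hq
  obtain ⟨j, rfl⟩ := Nat.exists_eq_add_of_le' hqk
  rw [beta_eq_profileCount (e := 2) (by omega), profileCount_excess_two,
    coeff_X_pow_mul_geomThree_pow (r := j + p + 1) (by omega),
    coeff_X_pow_mul_geomThree_pow (r := j + p + 1) (by omega), Nat.add_sub_cancel]
  have hk : j + (p + 1 + 5) - 6 = j + p := by omega
  have hk' : j + (p + 1 + 5) - 7 = j + p - 1 := by omega
  -- With k = q + 5 + j, the powers of 3 are compared with 3^(j - 1), whose exponent is -1 when j =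
  -- 0; hence integer exponents.
  have hz : (m : ℤ) - (2 * (p + 1) + 4 : ℕ) = j - 1 := by omega
  have hz' : (m : ℤ) - (2 * (p + 1) + 3 : ℕ) = j - 1 + 1 := by omega
  have hz'' : ((j + (p + 1 + 5) : ℕ) : ℤ) - (p + 1 : ℕ) - 6 = j - 1 := by omega
  rw [hk, hk', hz, hz', hz'', zpow_add_one₀ (by norm_num)]
  have h1 := add_one_mul_choose_cast (j + p) p
  have h2 := choose_succ_right_cast (j + p + 1) (p + 1)
  have h3 := natCast_mul_choose_pred (j + p) p
  push_cast at h1 h2 h3 ⊢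
  linear_combination 3 ^ ((j : ℤ) - 1) * (8 * (p + 1) * h2 + (8 * j + 60) * h1 -
    8 * (j + p + 1) * h3)

lemma beta_excess_three {k m q : ℕ} (hm : m + 3 = k + q) (hq : 1 ≤ q) (hqk : q + 7 ≤ k) :
    (beta (2 * k) m q : ℚ) = 4 * ((k : ℚ) - 7) * ((k - 8).choose (q - 1) : ℚ) *
      (8 * ((k : ℚ) - q) ^ 2 + 60 * ((k : ℚ) - q) - 137) * 3 ^ ((k : ℤ) - q - 10) := by
  obtain ⟨p, rfl⟩ := Nat.exists_eq_add_of_le' hq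
  obtain ⟨j, rfl⟩ := Nat.exists_eq_add_of_le' hqk
  have h := profileCount_excess_three m (p + 1)
  rw [coeff_X_pow_mul_geomThree_pow (r := j + p + 1) (by omega),
    coeff_X_pow_mul_geomThree_pow (r := j + p + 1) (by omega),
    coeff_X_pow_mul_geomThree_pow (r := j + p + 1) (by omega)] at h
  rw [beta_eq_profileCount (e := 3) (by omega), Nat.add_sub_cancel]
  have hk : j + (p + 1 + 7) - 8 = j + p := by omega
  have hz : (m : ℤ) - (2 * (p + 1) + 6 : ℕ) = j - 3 + 1 := by omega
  have hz' : (m : ℤ) - (2 * (p + 1) + 5 : ℕ) = j - 3 + 1 + 1 := by omega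
  have hz'' : (m : ℤ) - (2 * (p + 1) + 4 : ℕ) = j - 3 + 1 + 1 + 1 := by omega
  have hz3 : ((j + (p + 1 + 7) : ℕ) : ℤ) - (p + 1 : ℕ) - 10 = j - 3 := by omega
  have h0 : (3 : ℚ) ≠ 0 := by norm_num
  rw [hz, hz', hz''] at h
  simp only [zpow_add_one₀ h0] at h
  rw [hk, hz3]
  have h1 := add_one_mul_choose_cast (j + p) p
  have h2 := choose_succ_right_cast (j + p + 1) (p + 1)
  have h3 := choose_succ_right_cast (j + p + 1) (p + 2)
  push_cast at h h1 h2 h3 ⊢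
  -- All binomials reduce to C(j + p, p). In units of 3^(j - 3), the constants 32, 240, 300 become
  -- 96 = 32·3, 2160 = 240·9, 8100 = 300·27; the factors j - 1 and j come from `h3` and `h2`.
  linear_combination (1 / 3) * h + (1 / 3) * 3 ^ ((j : ℤ) - 3) *
    (96 * (p + 1) * (p + 2) * h3 + (96 * (j - 1) + 2160) * (p + 1) * h2 +
      ((96 * (j - 1) + 2160) * j + 8100) * h1)

/-- For q = 0 the prefactor q vanishes; otherwise m lies below 2q + 2, the lowest exponent of the
series. The next two lemmas use the same dichotomy. -/
lemma beta_excess_one_eq_zero {k m q : ℕ} (hm : m + 1 = k + q) (h : ¬ (1 ≤ q ∧ q + 3 ≤ k)) :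
    beta (2 * k) m q = 0 := by
  rw [beta_eq_profileCount (e := 1) (by omega), ← Nat.cast_eq_zero (R := ℚ),
    profileCount_excess_one]
  rcases Nat.eq_zero_or_pos q with rfl | hq
  · simp
  · rw [coeff_X_pow_mul_geomThree_pow_of_lt _ (by omega), mul_zero]

lemma beta_excess_two_eq_zero {k m q : ℕ} (hm : m + 2 = k + q) (h : ¬ (1 ≤ q ∧ q + 5 ≤ k)) :
    beta (2 * k) m q = 0 := by
  rw [beta_eq_profileCount (e := 2) (by omega), ← Nat.cast_eq_zero (R := ℚ),
    profileCount_excess_two]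
  rcases Nat.eq_zero_or_pos q with rfl | hq
  · simp
  · rw [coeff_X_pow_mul_geomThree_pow_of_lt _ (by omega),
      coeff_X_pow_mul_geomThree_pow_of_lt _ (by omega), mul_zero, mul_zero, add_zero]

lemma beta_excess_three_eq_zero {k m q : ℕ} (hm : m + 3 = k + q)
    (h : ¬ (1 ≤ q ∧ q + 7 ≤ k)) : beta (2 * k) m q = 0 := by
  have h3 := profileCount_excess_three m q
  rw [beta_eq_profileCount (e := 3) (by omega), ← Nat.cast_eq_zero (R := ℚ)]
  rcases Nat.eq_zero_or_pos q with rfl | hq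
  · simpa using h3
  · rw [coeff_X_pow_mul_geomThree_pow_of_lt _ (by omega),
      coeff_X_pow_mul_geomThree_pow_of_lt _ (by omega),
      coeff_X_pow_mul_geomThree_pow_of_lt _ (by omega)] at h3
    simpa using h3

end SplitTypes

theorem mainTheorem5 (k q : ℕ) (hk : 1 ≤ k) :
    (∀ m : ℕ, m = k + q → 1 ≤ q → q ≤ k →
      (SplitTypes.beta (2 * k) m q : ℚ) =
        ((k - 1).choose (q - 1) : ℚ) * 3 ^ ((k : ℤ) - q)) ∧
    (∀ m : ℕ, m + 1 = k + q →
      (1 ≤ q ∧ q + 3 ≤ k →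
        (SplitTypes.beta (2 * k) m q : ℚ) =
          4 * ((k : ℚ) - 3) * ((k - 4).choose (q - 1) : ℚ) * 3 ^ ((k : ℤ) - q - 3)) ∧
      (¬ (1 ≤ q ∧ q + 3 ≤ k) → SplitTypes.beta (2 * k) m q = 0)) ∧
    (∀ m : ℕ, m + 2 = k + q →
      (1 ≤ q ∧ q + 5 ≤ k →
        (SplitTypes.beta (2 * k) m q : ℚ) =
          4 * ((k : ℚ) - 5) *
            (2 * ((k : ℚ) - 6) * ((k - 7).choose (q - 1) : ℚ) +
              15 * ((k - 6).choose (q - 1) : ℚ)) * 3 ^ ((k : ℤ) - q - 6)) ∧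
      (¬ (1 ≤ q ∧ q + 5 ≤ k) → SplitTypes.beta (2 * k) m q = 0)) ∧
    (∀ m : ℕ, m + 3 = k + q →
      (1 ≤ q ∧ q + 7 ≤ k →
        (SplitTypes.beta (2 * k) m q : ℚ) =
          4 * ((k : ℚ) - 7) * ((k - 8).choose (q - 1) : ℚ) *
            (8 * ((k : ℚ) - q) ^ 2 + 60 * ((k : ℚ) - q) - 137) * 3 ^ ((k : ℤ) - q - 10)) ∧
      (¬ (1 ≤ q ∧ q + 7 ≤ k) → SplitTypes.beta (2 * k) m q = 0)) := by
  refine ⟨fun m hm hq hqk => SplitTypes.beta_excess_zero hm hq hqk, fun m hm => ⟨fun h => ?_, ?_⟩,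
    fun m hm => ⟨fun h => ?_, ?_⟩, fun m hm => ⟨fun h => ?_, ?_⟩⟩
  · exact SplitTypes.beta_excess_one hm h.1 h.2
  · exact SplitTypes.beta_excess_one_eq_zero hm
  · exact SplitTypes.beta_excess_two hm h.1 h.2
  · exact SplitTypes.beta_excess_two_eq_zero hm
  · exact SplitTypes.beta_excess_three hm h.1 h.2
  · exact SplitTypes.beta_excess_three_eq_zero hm
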